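/- There is a universal constant $C>0$ such that the following holds. For every $n$, let $G\sim G(n,p)$ be the Erdős–Rényi random graph on the vertex set $[n]=\{1,\dots,n\}$ in which each pair of distinct vertices is an edge independently with probability $p=\frac{C\ln n}{n}$ (for the finitely many $n$ with $\frac{C\ln n}{n}>1$, take $p=1$). Call a path in $G$ monotone if the sequence of its vertices, in the order in which the path visits them, is monotone (increasing or decreasing). Then, with probability tending to $1$ as $n\to\infty$, it holds simultaneously for all $i,j\in[n]$ with $|i-j|\ge \frac n8$ that $G$ contains a monotone path between $i$ and $j$. -/

import Mathlib

open Filter Topology MeasureTheory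
open scoped SimpleGraph

/-- A walk in a graph on an ordered vertex set is a *monotone path* if it is a path and the
sequence of vertices along it is monotone (increasing or decreasing). -/
def IsMonotonePath {V : Type*} [LinearOrder V] {G : SimpleGraph V} {u v : V}
    (w : G.Walk u v) : Prop :=
  w.IsPath ∧ (w.support.Pairwise (· ≤ ·) ∨ w.support.Pairwise (· ≥ ·))

/-- The edge probability `C ln n / n`. The projection to `[0, 1]` does nothing for `C ≥ 0` as soon
as `C ln n / n ≤ 1`, that is, for all large `n`. -/
noncomputable def edgeProb (C : ℝ) (n : ℕ) : unitInterval :=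
  Set.projIcc 0 1 zero_le_one (C * Real.log n / n)

/-- The event, on graphs with the `n` ordered vertices `Fin n`, that every two vertices `i, j` with
`|i - j| ≥ n / 8` are joined by a monotone path. -/
def farPairsMonotonelyConnected (n : ℕ) : Set (SimpleGraph (Fin n)) :=
  {G | ∀ i j : Fin n, (n : ℝ) / 8 ≤ |(i : ℝ) - (j : ℝ)| → ∃ w : G.Walk i j, IsMonotonePath w}

/-! Fix `i < j` and scan the vertices between them upwards, keeping the set `S` reached from `i` by
increasing paths. A new vertex joins `S` with probability `1 - q ^ |S|`, `q = 1 - p`, independently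
of the past, since its edges to `S` are unrevealed. The potential `q ^ x / (1 - q ^ x)` at `x = |S|`
dominates the chance that `S` misses `j`, and each vertex shrinks its mean by a factor `1 - p / 2`
(`potential_step`). Hence failure has probability at most `(1 - p / 2) ^ (j - i - 1) / p`, small
enough at `C = 64` for a union bound over pairs. -/

open ProbabilityTheory unitInterval

namespace SimpleGraph

variable {V : Type*}

/-! ### Revealing the edges at one vertex of a binomial random graph -/

lemma measurableSet_of_finite [Finite V] (A : Set (SimpleGraph V)) : MeasurableSet A :=
  measurableEmbedding_edgeSet.measurableSet_image.1 (Set.toFinite _).measurableSet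

/-- `A` is determined by the edges that avoid the set `T` of vertices. -/
def DeterminedOff (T : Set V) (A : Set (SimpleGraph V)) : Prop :=
  ∀ G H : SimpleGraph V, (∀ a b, a ∉ T → b ∉ T → (G.Adj a b ↔ H.Adj a b)) → (G ∈ A ↔ H ∈ A)

/-- No edge joins `v` to the set `S`. -/
def noEdge (S : Finset V) (v : V) : Set (SimpleGraph V) :=
  {G | ∀ s ∈ S, ¬ G.Adj s v}

lemma DeterminedOff.mono {T T' : Set V} {A : Set (SimpleGraph V)} (h : DeterminedOff T A)
    (hT : T' ⊆ T) : DeterminedOff T' A :=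
  fun G H hGH => h G H fun a b ha hb => hGH a b (fun h => ha (hT h)) (fun h => hb (hT h))

lemma DeterminedOff.inter {T : Set V} {A B : Set (SimpleGraph V)} (hA : DeterminedOff T A)
    (hB : DeterminedOff T B) : DeterminedOff T (A ∩ B) :=
  fun G H hGH => and_congr (hA G H hGH) (hB G H hGH)

lemma DeterminedOff.compl {T : Set V} {A : Set (SimpleGraph V)} (hA : DeterminedOff T A) :
    DeterminedOff T Aᶜ :=
  fun G H hGH => not_congr (hA G H hGH)

lemma determinedOff_noEdge {T : Set V} {S : Finset V} {v : V} (hS : ∀ s ∈ S, s ∉ T)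
    (hv : v ∉ T) : DeterminedOff T (noEdge S v) :=
  fun _ _ hGH => forall₂_congr fun s hs => not_congr (hGH s v (hS s hs) hv)

/-- The absence of a finite set of coordinates is independent of events determined by the other
coordinates. -/
lemma infinitePi_inter_of_disjoint {ι : Type*} [Fintype ι] [DecidableEq ι]
    (μ : ι → Measure Prop) [∀ i, IsProbabilityMeasure (μ i)] (F : Finset ι) (A : Set (ι → Prop))
    (hA : ∀ f g : ι → Prop, (∀ i ∉ F, f i = g i) → (f ∈ A ↔ g ∈ A)) :
    Measure.infinitePi μ (A ∩ {f | ∀ i ∈ F, ¬ f i}) =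
      Measure.infinitePi μ A * ∏ i ∈ F, μ i {False} := by
  have hind := (iIndepFun_infinitePi (P := μ) (X := fun _ x => x)
    (fun _ => measurable_id)).indepFun_finset Fᶜ F disjoint_compl_left
    (fun i => measurable_pi_apply i)
  -- `A` factors through the coordinates outside `F`: filling those in `F` with `False` does not
  -- affect membership.
  have hA' : A = (fun (a : ι → Prop) (i : (Fᶜ : Finset ι)) => a i) ⁻¹'
      {r | (fun i => if h : i ∈ Fᶜ then r ⟨i, h⟩ else False) ∈ A} := by
    ext f
    refine hA _ _ fun i hi => ?_
    simp [hi]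
  have hB : {f : ι → Prop | ∀ i ∈ F, ¬ f i} = (fun (a : ι → Prop) (i : F) => a i) ⁻¹'
      {fun _ => False} := by
    ext f
    simp [funext_iff]
  have hB' : {f : ι → Prop | ∀ i ∈ F, ¬ f i} = Set.pi (F : Set ι) fun _ => {False} := by
    ext f
    simp [Set.mem_pi]
  rw [← Measure.infinitePi_pi μ (fun i _ => MeasurableSet.singleton False), ← hB', hA', hB]
  exact hind.measure_inter_preimage_eq_mul _ _ (Set.toFinite _).measurableSet
    (Set.toFinite _).measurableSet

lemma binomialRandom_apply_infinitePi [Finite V] (p : I) (A : Set (SimpleGraph V)) :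
    G(V, p) A = Measure.infinitePi
      (fun e : Sym2 V => toNNReal p • Measure.dirac (e ∈ (Sym2.diagSetᶜ : Set (Sym2 V))) +
        toNNReal (σ p) • Measure.dirac False)
      {f | fromEdgeSet {e | f e} ∈ A} := by
  rw [binomialRandom_eq_map, Measure.map_apply measurable_fromEdgeSet (measurableSet_of_finite A),
    setBernoulli_apply']
  rfl

lemma binomialRandom_inter_noEdge [Finite V] (p : I) {S : Finset V} {v : V} (hv : v ∉ S)
    {A : Set (SimpleGraph V)} (hA : DeterminedOff {v} A) :
    G(V, p).real (A ∩ noEdge S v) = G(V, p).real A * (1 - (p : ℝ)) ^ S.card := by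
  classical
  cases nonempty_fintype V
  have hinj : Function.Injective fun s : V => s(s, v) := fun a b h => Sym2.congr_left.1 h
  have key := infinitePi_inter_of_disjoint
    (fun e : Sym2 V => toNNReal p • Measure.dirac (e ∈ (Sym2.diagSetᶜ : Set (Sym2 V))) +
        toNNReal (σ p) • Measure.dirac False) (S.image fun s => s(s, v))
    {f | fromEdgeSet {e | f e} ∈ A} fun f g hfg => hA _ _ fun a b ha hb => by
      have : f s(a, b) = g s(a, b) := hfg _ fun h => by
        obtain ⟨s, -, hs⟩ := Finset.mem_image.1 h
        have : v ∈ s(a, b) := hs ▸ Sym2.mem_mk_right s v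
        rcases Sym2.mem_iff.1 this with h | h
        · exact ha h.symm
        · exact hb h.symm
      simp [this]
  have hset : {f : Sym2 V → Prop | fromEdgeSet {e | f e} ∈ A ∩ noEdge S v} =
      {f | fromEdgeSet {e | f e} ∈ A} ∩ {f | ∀ e ∈ S.image fun s => s(s, v), ¬ f e} := by
    ext f
    refine and_congr_right fun _ => ?_
    simp only [noEdge, Set.mem_ofPred_eq, fromEdgeSet_adj, Finset.forall_mem_image]
    refine forall₂_congr fun s hs => ?_
    have : s ≠ v := fun h => hv (h ▸ hs)
    simp [this]
  have hprod : ∏ e ∈ S.image (fun s => s(s, v)),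
      (toNNReal p • Measure.dirac (e ∈ (Sym2.diagSetᶜ : Set (Sym2 V))) +
        toNNReal (σ p) • Measure.dirac False : Measure Prop) {False} =
      (toNNReal (σ p) : ENNReal) ^ S.card := by
    rw [Finset.prod_image fun a _ b _ h => hinj h, Finset.prod_eq_pow_card]
    intro s hs
    have : s ≠ v := fun h => hv (h ▸ hs)
    simp [this]
  rw [measureReal_def, measureReal_def, binomialRandom_apply_infinitePi, hset, key, hprod,
    ← binomialRandom_apply_infinitePi, ENNReal.toReal_mul, ENNReal.toReal_pow]
  simp

/-! ### Exploring the set of vertices reachable by increasing paths -/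

/-- Explore the vertices of the list `l` in order, adding to `S` every vertex that has a neighbour
in the current set. `deadEnd j l S` is the event that the final set has no neighbour of `j`. -/
def deadEnd [DecidableEq V] (j : V) : List V → Finset V → Set (SimpleGraph V)
  | [], S => noEdge S j
  | v :: l, S => (noEdge S v ∩ deadEnd j l S) ∪ ((noEdge S v)ᶜ ∩ deadEnd j l (insert v S))

/-- The potential `h x = q ^ x / (1 - q ^ x)` decreases on average by a constant factor when `x`
stays put with probability `q ^ x` and increases by one otherwise. -/
lemma potential_step {q : ℝ} (hq0 : 0 < q) (hq1 : q < 1) {x : ℕ} (hx : 1 ≤ x) :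
    q ^ x * (q ^ x / (1 - q ^ x)) + (1 - q ^ x) * (q ^ (x + 1) / (1 - q ^ (x + 1))) ≤
      (1 - (1 - q) / 2) * (q ^ x / (1 - q ^ x)) := by
  have hu0 : 0 < q ^ x := pow_pos hq0 x
  have huq : q ^ x ≤ q := pow_le_of_le_one hq0.le hq1.le (by omega)
  rw [pow_succ']
  set u := q ^ x
  have h1 : 0 < 1 - u := by linarith
  have h2 : 0 < 1 - q * u := by nlinarith
  have : (1 - (1 - q) / 2) * (u / (1 - u)) -
      (u * (u / (1 - u)) + (1 - u) * (q * u / (1 - q * u))) =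
      u * ((1 - q) * ((1 - u) - (1 - q * u) / 2)) / ((1 - u) * (1 - q * u)) := by
    have := h1.ne'
    have := h2.ne'
    field_simp
    ring
  -- Here `1 ≤ x` enters: `u ≤ q` gives `1 - q * u ≤ 1 - u ^ 2 ≤ 2 * (1 - u)`.
  have h3 : 0 ≤ (1 - u) - (1 - q * u) / 2 := by nlinarith
  have h4 : 0 ≤ 1 - q := by linarith
  have : 0 ≤ u * ((1 - q) * ((1 - u) - (1 - q * u) / 2)) / ((1 - u) * (1 - q * u)) := by
    positivity
  linarith

/-- `A` is the history of the exploration. Being determined off the unexplored vertices makes it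
independent of the next reveal, and the induction intersects it with each outcome. -/
lemma binomialRandom_inter_deadEnd_le [Finite V] [DecidableEq V] {p : I} (hp0 : 0 < (p : ℝ))
    (hp1 : (p : ℝ) < 1) (j : V) (l : List V) (S : Finset V) (hS : S.Nonempty)
    (hj : j ∉ S) (hl : ∀ v ∈ l, v ∉ S) (hnd : (j :: l).Nodup) (A : Set (SimpleGraph V))
    (hA : DeterminedOff {v | v ∈ j :: l} A) :
    G(V, p).real (A ∩ deadEnd j l S) ≤ G(V, p).real A * ((1 - (p : ℝ) / 2) ^ l.length *
      ((1 - (p : ℝ)) ^ S.card / (1 - (1 - (p : ℝ)) ^ S.card))) := by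
  have hq0 : 0 < 1 - (p : ℝ) := by linarith
  have hq1 : 1 - (p : ℝ) < 1 := by linarith
  induction l generalizing S A with
  | nil =>
    rw [deadEnd, binomialRandom_inter_noEdge p hj (hA.mono (by simp))]
    have h1 : 0 < (1 - (p : ℝ)) ^ S.card := pow_pos hq0 _
    have h2 : (1 - (p : ℝ)) ^ S.card < 1 := pow_lt_one₀ hq0.le hq1 hS.card_ne_zero
    refine mul_le_mul_of_nonneg_left ?_ measureReal_nonneg
    rw [List.length_nil, pow_zero, one_mul, le_div_iff₀ (by linarith)]
    nlinarith
  | cons v l ih =>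
    have hvS : v ∉ S := hl v (by simp)
    have hnd' : (j :: l).Nodup := hnd.sublist ((List.sublist_cons_self v l).cons_cons j)
    have hvj : v ≠ j := fun h => (List.nodup_cons.1 hnd).1 (by simp [h])
    have hvl : v ∉ l := (List.nodup_cons.1 (List.nodup_cons.1 hnd).2).1
    have hA' : DeterminedOff {w | w ∈ j :: l} A := hA.mono fun w hw => by
      simp only [Set.mem_ofPred_eq, List.mem_cons] at hw ⊢; tauto
    have hE : DeterminedOff {w | w ∈ j :: l} (noEdge S v) := by
      refine determinedOff_noEdge (fun s hs h => ?_) (by simp [hvj, hvl])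
      rcases List.mem_cons.1 h with rfl | h
      · exact hj hs
      · exact hl s (by simp [h]) hs
    have hP := binomialRandom_inter_noEdge p hvS (hA.mono (by simp))
    have hPc : G(V, p).real (A ∩ (noEdge S v)ᶜ) =
        G(V, p).real A * (1 - (1 - (p : ℝ)) ^ S.card) := by
      have := measureReal_inter_add_sdiff (μ := G(V, p)) (s := A)
        (measurableSet_of_finite (noEdge S v))
      rw [Set.sdiff_eq_compl_inter, Set.inter_comm _ A] at this
      linarith
    have ih1 := ih S hS hj (fun w hw => hl w (by simp [hw])) hnd' _ (hA'.inter hE)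
    have ih2 := ih (insert v S) (Finset.insert_nonempty v S) (by simp [hj, hvj.symm])
      (fun w hw => by
        have : w ≠ v := fun h => hvl (h ▸ hw)
        simp [this, hl w (by simp [hw])]) hnd' _ (hA'.inter hE.compl)
    rw [hP] at ih1
    rw [hPc, Finset.card_insert_of_notMem hvS] at ih2
    have hstep := potential_step hq0 hq1 (Finset.card_pos.2 hS)
    rw [deadEnd, Set.inter_union_distrib_left, ← Set.inter_assoc, ← Set.inter_assoc]
    refine (measureReal_union_le _ _).trans ((add_le_add ih1 ih2).trans ?_)
    have hc : 0 ≤ G(V, p).real A * (1 - (p : ℝ) / 2) ^ l.length :=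
      mul_nonneg measureReal_nonneg (pow_nonneg (by linarith) _)
    have := mul_le_mul_of_nonneg_left hstep hc
    rw [List.length_cons, pow_succ (1 - (p : ℝ) / 2)]
    rw [sub_sub_cancel] at this
    linarith

/-- `i` and `v` are joined by a walk along which the vertices increase strictly. -/
def IncreasinglyReachable [LinearOrder V] (G : SimpleGraph V) (i v : V) : Prop :=
  ∃ w : G.Walk i v, w.support.Pairwise (· < ·) ∧ ∀ x ∈ w.support, x ≤ v

lemma IncreasinglyReachable.adj [LinearOrder V] {G : SimpleGraph V} {i u v : V}
    (h : G.IncreasinglyReachable i u) (huv : u < v) (hadj : G.Adj u v) :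
    G.IncreasinglyReachable i v := by
  obtain ⟨w, hw, hle⟩ := h
  refine ⟨w.concat hadj, ?_, ?_⟩
  · rw [Walk.support_concat]
    simp only [List.pairwise_append, List.mem_singleton]
    exact ⟨hw, by simp, fun a ha b hb => hb ▸ (hle a ha).trans_lt huv⟩
  · rw [Walk.support_concat]
    intro x hx
    rcases List.mem_append.1 hx with hx | hx
    · exact (hle x hx).trans huv.le
    · exact (List.mem_singleton.1 hx).le

/-- Since `l` is sorted and lies above `S`, every edge used by the exploration goes upwards and
extends an increasing walk. -/
lemma increasinglyReachable_of_notMem_deadEnd [LinearOrder V] {G : SimpleGraph V} {i j : V}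
    (l : List V) (S : Finset V) (hS : ∀ s ∈ S, G.IncreasinglyReachable i s)
    (hj : ∀ s ∈ S, s < j) (hlj : ∀ v ∈ l, v < j) (hl : ∀ v ∈ l, ∀ s ∈ S, s < v)
    (hsort : l.Pairwise (· < ·)) (hG : G ∉ deadEnd j l S) : G.IncreasinglyReachable i j := by
  induction l generalizing S with
  | nil =>
    simp only [deadEnd, noEdge, Set.mem_ofPred_eq, not_forall, not_not] at hG
    obtain ⟨s, hs, hadj⟩ := hG
    exact (hS s hs).adj (hj s hs) hadj
  | cons v l ih =>
    have hsort' := List.pairwise_cons.1 hsort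
    by_cases hE : G ∈ noEdge S v
    · exact ih S hS hj (fun w hw => hlj w (by simp [hw])) (fun w hw => hl w (by simp [hw]))
        hsort'.2 fun h => hG (Or.inl ⟨hE, h⟩)
    · have hv : G.IncreasinglyReachable i v := by
        simp only [noEdge, Set.mem_ofPred_eq, not_forall, not_not] at hE
        obtain ⟨s, hs, hadj⟩ := hE
        exact (hS s hs).adj (hl v (by simp) s hs) hadj
      refine ih (insert v S) ?_ ?_ (fun w hw => hlj w (by simp [hw])) ?_ hsort'.2
        fun h => hG (Or.inr ⟨hE, h⟩)
      · simpa [hv] using hS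
      · simpa [hlj v (by simp)] using hj
      · intro w hw s hs
        rcases Finset.mem_insert.1 hs with rfl | hs
        · exact hsort'.1 w hw
        · exact hl w (by simp [hw]) s hs

lemma IncreasinglyReachable.exists_isMonotonePath [LinearOrder V] {G : SimpleGraph V} {i j : V}
    (h : G.IncreasinglyReachable i j) : ∃ w : G.Walk i j, IsMonotonePath w := by
  obtain ⟨w, hw, -⟩ := h
  exact ⟨w, Walk.IsPath.mk' (hw.imp ne_of_lt), Or.inl (hw.imp le_of_lt)⟩

lemma IncreasinglyReachable.exists_isMonotonePath_symm [LinearOrder V] {G : SimpleGraph V}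
    {i j : V} (h : G.IncreasinglyReachable i j) : ∃ w : G.Walk j i, IsMonotonePath w := by
  obtain ⟨w, hw, -⟩ := h
  refine ⟨w.reverse, (Walk.IsPath.mk' (hw.imp ne_of_lt)).reverse, Or.inr ?_⟩
  rw [Walk.support_reverse, List.pairwise_reverse]
  exact hw.imp le_of_lt

lemma binomialRandom_not_increasinglyReachable_le {n : ℕ} {p : I} (hp0 : 0 < (p : ℝ))
    (hp1 : (p : ℝ) < 1) {i j : Fin n} (hij : i < j) :
    G(Fin n, p).real {G | ¬ G.IncreasinglyReachable i j} ≤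
      (1 - (p : ℝ) / 2) ^ ((j : ℕ) - i - 1) / p := by
  set l := (Finset.Ioo i j).sort (· ≤ ·) with hl
  have hmem : ∀ v, v ∈ l ↔ i < v ∧ v < j := fun v => by simp [hl]
  have hlen : l.length = (j : ℕ) - i - 1 := by simp [hl]
  have hsub : {G : SimpleGraph (Fin n) | ¬ G.IncreasinglyReachable i j} ⊆
      Set.univ ∩ deadEnd j l {i} := by
    refine fun G hG => ⟨trivial, by_contra fun h => hG ?_⟩
    refine increasinglyReachable_of_notMem_deadEnd l {i} ?_ (by simpa) (fun v hv => ((hmem v).1 hv).2)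
      (fun v hv => by simpa using ((hmem v).1 hv).1) (Finset.sortedLT_sort _).pairwise h
    intro s hs
    rw [Finset.mem_singleton.1 hs]
    exact ⟨Walk.nil, by simp, by simp⟩
  have := binomialRandom_inter_deadEnd_le hp0 hp1 j l {i} (by simp) (by simp [hij.ne'])
    (fun v hv => by simp [((hmem v).1 hv).1.ne'])
    (List.nodup_cons.2 ⟨fun h => ((hmem j).1 h).2.false, Finset.sort_nodup _ _⟩)
    Set.univ (fun _ _ _ => Iff.rfl)
  refine (measureReal_mono hsub).trans (this.trans ?_)
  rw [Finset.card_singleton, pow_one, sub_sub_cancel, hlen, probReal_univ, one_mul, mul_div_assoc']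
  have h : (0 : ℝ) ≤ (1 - (p : ℝ) / 2) ^ ((j : ℕ) - i - 1) := pow_nonneg (by linarith) _
  gcongr
  nlinarith

end SimpleGraph

/-! ### Union bound over far pairs -/

lemma compl_farPairsMonotonelyConnected_subset (n : ℕ) :
    (farPairsMonotonelyConnected n)ᶜ ⊆
      ⋃ x ∈ (Finset.univ : Finset (Fin n × Fin n)).filter
        (fun x => x.1 < x.2 ∧ (n : ℝ) / 8 ≤ (x.2 : ℝ) - (x.1 : ℝ)),
        {G | ¬ G.IncreasinglyReachable x.1 x.2} := by
  intro G hG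
  by_contra hcon
  simp only [Set.mem_iUnion, Finset.mem_filter, Finset.mem_univ, true_and, Set.mem_ofPred_eq,
    not_exists, not_not, Prod.forall] at hcon
  refine hG fun i j hij => ?_
  rcases lt_trichotomy i j with h | rfl | h
  · have hc : ((i : ℕ) : ℝ) < ((j : ℕ) : ℝ) := by exact_mod_cast h
    rw [abs_sub_comm, abs_of_pos (by linarith)] at hij
    exact (hcon i j ⟨h, hij⟩).exists_isMonotonePath
  · exact ⟨SimpleGraph.Walk.nil, by simp [IsMonotonePath]⟩
  · have hc : ((j : ℕ) : ℝ) < ((i : ℕ) : ℝ) := by exact_mod_cast h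
    rw [abs_of_pos (by linarith)] at hij
    exact (hcon j i ⟨h, hij⟩).exists_isMonotonePath_symm

lemma edgeProb_eq {C : ℝ} {n : ℕ} (h0 : 0 ≤ C * Real.log n / n) (h1 : C * Real.log n / n ≤ 1) :
    (edgeProb C n : ℝ) = C * Real.log n / n := by
  rw [edgeProb, Set.projIcc_of_mem zero_le_one ⟨h0, h1⟩]

lemma binomialRandom_compl_farPairsMonotonelyConnected_le {n : ℕ} (hn : 3 ≤ n)
    (h1 : 64 * Real.log n / n < 1) :
    G(Fin n, edgeProb 64 n).real (farPairsMonotonelyConnected n)ᶜ ≤ Real.exp 1 / n := by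
  have hn0 : (0 : ℝ) < n := by positivity
  have hlog : 1 ≤ Real.log n := by
    rw [Real.le_log_iff_exp_le hn0]
    have : (3 : ℝ) ≤ n := by exact_mod_cast hn
    linarith [Real.exp_one_lt_d9]
  have hp0 : 0 < 64 * Real.log n / n := by positivity
  have hp := edgeProb_eq hp0.le h1.le
  set p := edgeProb 64 n
  have hinv : 1 / (p : ℝ) ≤ n := by
    rw [hp, one_div_div, div_le_iff₀ (by positivity)]
    nlinarith
  -- The constant 64 makes `p / 2 * (n / 8)` equal to `4 * log n`; the leftover `p / 2` is absorbed
  -- by `exp 1`. Of the resulting `n ^ (-4)`, the factor `1 / p` costs one power of `n` and the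
  -- pairs cost two.
  have hexp : Real.exp (-(p : ℝ) / 2 * (n / 8 - 1)) ≤ Real.exp 1 / n ^ 4 := by
    have : (n : ℝ) ^ 4 = Real.exp (4 * Real.log n) := by
      rw [mul_comm, Real.exp_mul, Real.exp_log hn0]; norm_cast
    rw [this, ← Real.exp_sub, Real.exp_le_exp]
    have : (p : ℝ) * n = 64 * Real.log n := by rw [hp]; field_simp
    have : (p : ℝ) < 1 := hp ▸ h1
    linarith
  refine (measureReal_mono (compl_farPairsMonotonelyConnected_subset n) (measure_ne_top _ _)).trans
    ((measureReal_biUnion_finset_le _ _).trans ((Finset.sum_le_card_nsmul _ _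
      (Real.exp 1 / n ^ 4 * n) ?_).trans ?_))
  · rintro ⟨i, j⟩ hx
    obtain ⟨hij, hgap⟩ := (Finset.mem_filter.1 hx).2
    refine (SimpleGraph.binomialRandom_not_increasinglyReachable_le (hp ▸ hp0) (hp ▸ h1) hij).trans ?_
    rw [div_eq_mul_one_div]
    refine mul_le_mul (le_trans ?_ hexp) hinv (by rw [hp]; positivity) (by positivity)
    have hp2 : (p : ℝ) < 1 := hp ▸ h1
    have hp3 : 0 < (p : ℝ) := hp ▸ hp0
    have hc : (((j : ℕ) - i - 1 : ℕ) : ℝ) = (j : ℝ) - i - 1 := by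
      have : (i : ℕ) < j := hij
      rw [Nat.cast_sub (by omega), Nat.cast_sub (by omega), Nat.cast_one]
    calc (1 - (p : ℝ) / 2) ^ ((j : ℕ) - i - 1)
        ≤ Real.exp (-((p : ℝ) / 2)) ^ ((j : ℕ) - i - 1) :=
          pow_le_pow_left₀ (by linarith) (Real.one_sub_le_exp_neg _) _
      _ = Real.exp (-(p : ℝ) / 2 * ((j : ℝ) - i - 1)) := by
          rw [← Real.exp_nat_mul, hc]; ring_nf
      _ ≤ Real.exp (-(p : ℝ) / 2 * (n / 8 - 1)) := by
          rw [Real.exp_le_exp]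
          simp only at hgap
          nlinarith
  · rw [nsmul_eq_mul]
    have hcard : (((Finset.univ : Finset (Fin n × Fin n)).filter
        (fun x => x.1 < x.2 ∧ (n : ℝ) / 8 ≤ (x.2 : ℝ) - (x.1 : ℝ))).card : ℝ) ≤ n ^ 2 := by
      refine (Nat.cast_le.2 (Finset.card_filter_le _ _)).trans ?_
      simp [sq]
    calc _ ≤ (n : ℝ) ^ 2 * (Real.exp 1 / n ^ 4 * n) := by gcongr
      _ = Real.exp 1 / n := by field_simp

theorem mainTheorem7 :
    ∃ C : ℝ, 0 < C ∧
      Tendsto (fun n : ℕ => G(Fin n, edgeProb C n) (farPairsMonotonelyConnected n))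
        atTop (𝓝 1) := by
  refine ⟨64, by norm_num, ?_⟩
  have hlim : Tendsto (fun n : ℕ => 64 * Real.log n / n) atTop (𝓝 0) := by
    have := (Real.isLittleO_log_id_atTop.tendsto_div_nhds_zero.comp
      tendsto_natCast_atTop_atTop).const_mul 64
    simpa [Function.comp_def, mul_div_assoc] using this
  have hbound : Tendsto (fun n : ℕ => 1 - Real.exp 1 / (n : ℝ)) atTop (𝓝 1) := by
    simpa using (tendsto_const_div_atTop_nhds_zero_nat (Real.exp 1)).const_sub 1
  have hreal : Tendsto (fun n : ℕ => G(Fin n, edgeProb 64 n).real (farPairsMonotonelyConnected n))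
      atTop (𝓝 1) := by
    refine tendsto_of_tendsto_of_tendsto_of_le_of_le' hbound tendsto_const_nhds ?_
      (Eventually.of_forall fun n => measureReal_le_one)
    filter_upwards [eventually_ge_atTop 3, hlim.eventually_lt_const one_pos] with n hn h1
    have := binomialRandom_compl_farPairsMonotonelyConnected_le hn h1
    rw [probReal_compl_eq_one_sub (SimpleGraph.measurableSet_of_finite _)] at this
    linarith
  simpa [measureReal_def, ENNReal.ofReal_toReal] using ENNReal.tendsto_ofReal hreal
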